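/- Corollary 1 (Jarník–Besicovitch). For a real number $\tau$ let $$J(\tau)=\Big\{x\in[0,1):\ \Big|x-\frac pq\Big|<\frac1{q^{\tau}}\ \text{ for infinitely many pairs }(p,q)\in\mathbb Z\times\mathbb N\Big\},$$ where $\mathbb N=\{1,2,3,\dots\}$. Then for every real $\tau\ge 2$ the Hausdorff dimension of $J(\tau)$ is $$\dim_{\mathrm H}J(\tau)=\frac2\tau .$$ -/

import Mathlib

/-- The set `J(τ)` of all `x ∈ [0, 1)` such that `|x - p / q| < 1 / q ^ τ` for infinitely many pairs
`(p, q)` of an integer `p` and a positive integer `q` (the pairs need not be coprime). -/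
def jarnikSet (τ : ℝ) : Set ℝ :=
  {x : ℝ | x ∈ Set.Ico (0 : ℝ) 1 ∧
    {pq : ℤ × ℕ | 0 < pq.2 ∧ |x - (pq.1 : ℝ) / (pq.2 : ℝ)| < 1 / (pq.2 : ℝ) ^ τ}.Infinite}

/-!
Upper bound. For each `N`, the intervals of radius `1 / q ^ τ` about `p / q`, `0 ≤ p ≤ q`, `q ≥ N`,
cover `jarnikSet τ`, and the sum of the `d`-th powers of their lengths is the tail of a convergent
series as soon as `d > 2 / τ` (`hausdorffMeasure_jarnikSet_eq_zero`).

Lower bound. For `0 < s < 2 / τ`, a measure with `μ I ≤ 2 |I| ^ s` on intervals is built on a subset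
of `jarnikSet τ`, so that `jarnikSet τ` is not `μH[s]`-null. The measure is the limit of densities
`f₀ = 1`, `f₁ = f₀ g₀`, `f₂ = f₁ g₁`, …, where `gₖ` is a `C¹` kernel `ratKernel` supported within
`(2n) ^ (-τ) / 2` of the fractions `p / q`, `0 < p < q`, `q` prime in `(n, 2n]`, for a huge `n`
depending on `fₖ`.

Two properties of the kernel make this work. It is close to Lebesgue measure on `[0, 1]`, so
multiplying `fₖ` by it barely changes the mass of intervals that are not very short
(`abs_integral_mul_sub_le`). And it satisfies a Hölder condition of an exponent `σ > s` with a
constant independent of `n` (`integral_ratKernel_le_rpow`), which takes care of very short intervals,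
where the spare factor `|I| ^ (σ - s)` beats the supremum of `fₖ`. The Hölder condition holds because
fractions with distinct prime denominators in `(n, 2n]` are distinct, hence `1 / (4n²)`-separated,
while for infinitely many `n` there are at least `n ^ (1 - ε)` such primes (`exists_many_primes`), so
that each fraction carries mass at most `n ^ (-2 + ε)`. The step is `exists_refinement`; passing to the
limit is `hausdorffMeasure_iInter_tsupport_ne_zero`.
-/

open Set Filter Topology MeasureTheory
open scoped ENNReal NNReal

/-! ### The upper bound: covering by all fractions with large denominator -/

/-- For `d > 2 / τ`, the canonical cover by `q + 1` intervals of length `2 / q ^ τ` for each `q` has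
finite total `d`-dimensional size. -/
lemma summable_cover_size {τ d : ℝ} (hτ : 2 ≤ τ) (hd : 2 / τ < d) :
    Summable fun q : ℕ => ((q : ℝ) + 1) * (2 / (q : ℝ) ^ τ) ^ d := by
  have hτ0 : 0 < τ := by linarith
  have hd0 : 0 < d := lt_trans (by positivity) hd
  have h1 : 2 < d * τ := (div_lt_iff₀ hτ0).1 hd
  have hs : Summable fun q : ℕ => 2 * (2 : ℝ) ^ d * (q : ℝ) ^ (1 - d * τ) :=
    (Real.summable_nat_rpow.2 (by linarith)).mul_left _
  refine Summable.of_nonneg_of_le (fun q => by positivity) (fun q => ?_) hs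
  rcases Nat.eq_zero_or_pos q with rfl | hq
  · have : (0 : ℝ) ^ τ = 0 := Real.zero_rpow hτ0.ne'
    simp only [Nat.cast_zero, this, div_zero, Real.zero_rpow hd0.ne', mul_zero]
    positivity
  · have hq1 : (1 : ℝ) ≤ q := by exact_mod_cast hq
    have hq0 : (0 : ℝ) < q := by linarith
    rw [Real.div_rpow zero_le_two (by positivity), ← Real.rpow_mul hq0.le, Real.rpow_sub hq0,
      Real.rpow_one, mul_comm τ d, div_eq_mul_inv, div_eq_mul_inv]
    have : 0 ≤ (2 : ℝ) ^ d * ((q : ℝ) ^ (d * τ))⁻¹ := by positivity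
    nlinarith

/-- Membership in `jarnikSet τ` forces good approximations with arbitrarily large denominator:
for each `q` only the finitely many numerators `0, …, q` can occur. -/
lemma exists_large_denominator {τ x : ℝ} (hτ : 2 ≤ τ) (hx : x ∈ jarnikSet τ) (n : ℕ) :
    ∃ q p : ℕ, n ≤ q ∧ 0 < q ∧ p ≤ q ∧ |x - (p : ℝ) / q| < 1 / (q : ℝ) ^ τ := by
  obtain ⟨⟨hx0, hx1⟩, hinf⟩ := hx
  have key : ∀ pq ∈ {pq : ℤ × ℕ | 0 < pq.2 ∧
      |x - (pq.1 : ℝ) / (pq.2 : ℝ)| < 1 / (pq.2 : ℝ) ^ τ}, 0 ≤ pq.1 ∧ pq.1 ≤ pq.2 := by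
    rintro ⟨p, q⟩ ⟨hq, h⟩
    simp only at hq h ⊢
    have hq1 : (1 : ℝ) ≤ q := by exact_mod_cast hq
    have hq0 : (0 : ℝ) < q := by linarith
    have h2 : 1 / (q : ℝ) ^ τ ≤ 1 / q := by
      apply one_div_le_one_div_of_le hq0
      calc (q : ℝ) = (q : ℝ) ^ (1 : ℝ) := (Real.rpow_one _).symm
        _ ≤ (q : ℝ) ^ τ := Real.rpow_le_rpow_of_exponent_le hq1 (by linarith)
    have h3 := abs_lt.1 (h.trans_le h2)
    have e1 : (p : ℝ) / q * q = p := div_mul_cancel₀ _ hq0.ne'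
    have e2 : 1 / (q : ℝ) * q = 1 := div_mul_cancel₀ _ hq0.ne'
    have h4 : (-1 : ℝ) < p := by nlinarith [h3.1, h3.2]
    have h5 : (p : ℝ) < q + 1 := by nlinarith [h3.1, h3.2]
    have h4' : (-1 : ℤ) < p := by exact_mod_cast h4
    have h5' : p < (q : ℤ) + 1 := by exact_mod_cast h5
    omega
  by_contra! hno
  refine hinf ((((Finset.Icc (0 : ℤ) n) ×ˢ (Finset.range n)).finite_toSet).subset ?_)
  rintro ⟨p, q⟩ hpq
  obtain ⟨hp0, hpq1⟩ := key _ hpq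
  obtain ⟨hq, h⟩ := hpq
  simp only at hp0 hpq1 hq h
  lift p to ℕ using hp0
  have hqn : q < n := by
    by_contra! hn
    exact absurd h (not_lt.2 (by simpa using hno q p hn hq (by exact_mod_cast hpq1)))
  simp only [Finset.coe_product, Set.mem_prod, Finset.mem_coe, Finset.mem_Icc, Finset.mem_range]
  omega

lemma hausdorffMeasure_jarnikSet_eq_zero {τ d : ℝ} (hτ : 2 ≤ τ) (hd : 2 / τ < d) :
    μH[d] (jarnikSet τ) = 0 := by
  have hτ0 : 0 < τ := by linarith
  have hd0 : 0 < d := lt_trans (by positivity) hd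
  let t : ∀ n : ℕ, (Σ q : ℕ, Fin (q + (n + 1) + 1)) → Set ℝ := fun n i =>
    Metric.closedBall ((i.2 : ℝ) / ((i.1 + (n + 1) : ℕ) : ℝ)) (1 / ((i.1 + (n + 1) : ℕ) : ℝ) ^ τ)
  have hdiam : ∀ n i, Metric.ediam (t n i) ≤
      ENNReal.ofReal (2 / ((i.1 + (n + 1) : ℕ) : ℝ) ^ τ) := fun n i => by
    refine Metric.ediam_le_of_forall_dist_le fun x hx y hy => ?_
    have := dist_triangle_right x y ((i.2 : ℝ) / ((i.1 + (n + 1) : ℕ) : ℝ))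
    have hx' := Metric.mem_closedBall.1 hx
    have hy' := Metric.mem_closedBall.1 hy
    have h2 : 2 / ((i.1 + (n + 1) : ℕ) : ℝ) ^ τ = 1 / ((i.1 + (n + 1) : ℕ) : ℝ) ^ τ
        + 1 / ((i.1 + (n + 1) : ℕ) : ℝ) ^ τ := by ring
    linarith
  have hr : Tendsto (fun n : ℕ => ENNReal.ofReal (2 / ((n : ℝ) + 1))) atTop (𝓝 0) := by
    rw [← ENNReal.ofReal_zero]
    refine (ENNReal.continuous_ofReal.tendsto 0).comp ?_
    have := (tendsto_one_div_add_atTop_nhds_zero_nat (𝕜 := ℝ)).const_mul 2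
    simpa [div_eq_mul_inv] using this
  have hle := Measure.hausdorffMeasure_le_liminf_tsum d (jarnikSet τ) _ hr t
    (Eventually.of_forall fun n i => (hdiam n i).trans (ENNReal.ofReal_le_ofReal ?_))
    (Eventually.of_forall fun n x hx => ?_)
  · refine le_antisymm (hle.trans ?_) zero_le
    let F : ℕ → ℝ≥0∞ := fun q => ENNReal.ofReal (((q : ℝ) + 1) * (2 / (q : ℝ) ^ τ) ^ d)
    have hF : ∑' q, F q ≠ ∞ := (summable_cover_size hτ hd).tsum_ofReal_ne_top
    have hlim : Tendsto (fun n : ℕ => ∑' q, F (q + (n + 1))) atTop (𝓝 0) :=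
      (ENNReal.tendsto_sum_nat_add F hF).comp (tendsto_add_atTop_nat 1)
    rw [← hlim.liminf_eq]
    refine liminf_le_liminf (Eventually.of_forall fun n => ?_)
    rw [ENNReal.tsum_sigma']
    refine ENNReal.tsum_le_tsum fun q => ?_
    calc ∑' p : Fin (q + (n + 1) + 1), Metric.ediam (t n ⟨q, p⟩) ^ d
        ≤ ∑' p : Fin (q + (n + 1) + 1),
            ENNReal.ofReal (2 / ((q + (n + 1) : ℕ) : ℝ) ^ τ) ^ d :=
          ENNReal.tsum_le_tsum fun p => ENNReal.rpow_le_rpow (hdiam n ⟨q, p⟩) hd0.le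
      _ = F (q + (n + 1)) := by
          rw [tsum_fintype, Finset.sum_const, Finset.card_univ, Fintype.card_fin, nsmul_eq_mul,
            ENNReal.ofReal_rpow_of_nonneg (by positivity) hd0.le]
          simp only [F]
          rw [ENNReal.ofReal_mul (by positivity)]
          congr 1
          rw [← Nat.cast_add_one, ENNReal.ofReal_natCast]
  · have h1 : (1 : ℝ) ≤ ((i.1 + (n + 1) : ℕ) : ℝ) := by exact_mod_cast (by omega)
    apply div_le_div_of_nonneg_left zero_le_two (by positivity)
    calc (n : ℝ) + 1 ≤ ((i.1 + (n + 1) : ℕ) : ℝ) := by push_cast; linarith [Nat.cast_nonneg (α := ℝ) i.1]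
      _ = ((i.1 + (n + 1) : ℕ) : ℝ) ^ (1 : ℝ) := (Real.rpow_one _).symm
      _ ≤ _ := Real.rpow_le_rpow_of_exponent_le h1 (by linarith)
  · obtain ⟨q, p, hnq, hq, hp, h⟩ := exists_large_denominator hτ hx (n + 1)
    obtain ⟨m, rfl⟩ := Nat.exists_eq_add_of_le' hnq
    refine mem_iUnion.2 ⟨⟨m, ⟨p, by omega⟩⟩, ?_⟩
    exact Metric.mem_closedBall.2 (by rw [Real.dist_eq]; exact h.le)

lemma dimH_jarnikSet_le {τ : ℝ} (hτ : 2 ≤ τ) : dimH (jarnikSet τ) ≤ ENNReal.ofReal (2 / τ) := by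
  refine dimH_le fun d hd => ?_
  by_contra! hlt
  rw [ENNReal.ofReal, ENNReal.coe_lt_coe, Real.toNNReal_lt_iff_lt_coe (by positivity)] at hlt
  rw [hausdorffMeasure_jarnikSet_eq_zero hτ hlt] at hd
  exact ENNReal.zero_ne_top hd

/-! ### Many primes in `(n, 2n]` -/

/-- Since `∑ 1 / p` diverges, the interval `(n, 2n]` contains at least `n ^ (1 - ε)` primes for
arbitrarily large `n`. -/
lemma exists_many_primes {ε : ℝ} (hε : 0 < ε) (N : ℕ) :
    ∃ n : ℕ, N ≤ n ∧ (n : ℝ) ^ (1 - ε) ≤ ((Finset.Ioc n (2 * n)).filter Nat.Prime).card := by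
  by_contra! H
  apply not_summable_one_div_on_primes
  set a : ℕ → ℝ := indicator {p | p.Prime} (fun n : ℕ ↦ (1 : ℝ) / n) with ha
  have ha0 : ∀ n, 0 ≤ a n := fun n => indicator_nonneg (fun _ _ => by positivity) n
  set ρ : ℝ := (2 : ℝ) ^ (-ε) with hρ
  have hρ0 : 0 ≤ ρ := by positivity
  have hρ1 : ρ < 1 := Real.rpow_lt_one_of_one_lt_of_neg one_lt_two (by linarith)
  -- a block starting at `2 ^ k` contributes at most `ρ ^ k`
  have hblock : ∀ k : ℕ, N ≤ k → ∑ p ∈ Finset.Ioc (2 ^ k) (2 * 2 ^ k), a p ≤ ρ ^ k := by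
    intro k hk
    have hpow : (0 : ℝ) < 2 ^ k := by positivity
    have h1 := (H (2 ^ k) (hk.trans Nat.lt_two_pow_self.le)).le
    have h2 : ∑ p ∈ Finset.Ioc (2 ^ k) (2 * 2 ^ k), a p
        = ∑ p ∈ (Finset.Ioc (2 ^ k) (2 * 2 ^ k)).filter Nat.Prime, (1 : ℝ) / p := by
      rw [Finset.sum_filter]
      exact Finset.sum_congr rfl fun p _ => by simp [ha, indicator_apply]
    rw [h2]
    calc _ ≤ ∑ p ∈ (Finset.Ioc (2 ^ k) (2 * 2 ^ k)).filter Nat.Prime, 1 / (2 : ℝ) ^ k := by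
          refine Finset.sum_le_sum fun p hp => ?_
          have : 2 ^ k < p := (Finset.mem_Ioc.1 (Finset.mem_filter.1 hp).1).1
          exact one_div_le_one_div_of_le hpow (by exact_mod_cast this.le)
      _ ≤ ((2 ^ k : ℕ) : ℝ) ^ (1 - ε) * (1 / (2 : ℝ) ^ k) := by
          rw [Finset.sum_const, nsmul_eq_mul]
          gcongr
      _ = ρ ^ k := by
          push_cast
          rw [sub_eq_add_neg, Real.rpow_add hpow, Real.rpow_one, hρ, ← Real.rpow_natCast,
            ← Real.rpow_mul zero_le_two, ← Real.rpow_natCast ((2 : ℝ) ^ (-ε)),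
            ← Real.rpow_mul zero_le_two, mul_comm (-ε)]
          field_simp
  have hpart : ∀ k : ℕ, ∑ p ∈ Finset.range (2 ^ (N + k) + 1), a p
      ≤ ∑ p ∈ Finset.range (2 ^ N + 1), a p + ∑ j ∈ Finset.range k, ρ ^ j := by
    intro k
    induction k with
    | zero => simp
    | succ k ih =>
      have hsplit : ∑ p ∈ Finset.range (2 ^ (N + (k + 1)) + 1), a p
          = ∑ p ∈ Finset.range (2 ^ (N + k) + 1), a p
            + ∑ p ∈ Finset.Ioc (2 ^ (N + k)) (2 * 2 ^ (N + k)), a p := by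
        have h2 : 2 ^ (N + (k + 1)) = 2 * 2 ^ (N + k) := by ring
        rw [h2, ← Finset.sum_range_add_sum_Ico a
          (show 2 ^ (N + k) + 1 ≤ 2 * 2 ^ (N + k) + 1 by omega)]
        congr 2
        ext p
        simp only [Finset.mem_Ico, Finset.mem_Ioc]
        omega
      rw [hsplit, Finset.sum_range_succ (fun j => ρ ^ j)]
      have h3 : ρ ^ (N + k) ≤ ρ ^ k := pow_le_pow_of_le_one hρ0 hρ1.le (by omega)
      linarith [hblock (N + k) (by omega)]
  refine summable_of_sum_range_le (c := ∑ p ∈ Finset.range (2 ^ N + 1), a p + (1 - ρ)⁻¹) ha0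
    fun n => ?_
  have h1 : ∑ p ∈ Finset.range n, a p ≤ ∑ p ∈ Finset.range (2 ^ (N + n) + 1), a p := by
    refine Finset.sum_le_sum_of_subset_of_nonneg (Finset.range_mono ?_) fun i _ _ => ha0 i
    have h2 : n < 2 ^ n := Nat.lt_two_pow_self
    have h3 : 2 ^ n ≤ 2 ^ (N + n) := Nat.pow_le_pow_right (by norm_num) (by omega)
    omega
  have h4 : ∑ j ∈ Finset.range n, ρ ^ j ≤ (1 - ρ)⁻¹ := by
    rw [← tsum_geometric_of_lt_one hρ0 hρ1]
    exact (summable_geometric_of_lt_one hρ0 hρ1).sum_le_tsum _ fun i _ => by positivity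
  linarith [hpart n]

/-! ### Bumps at fractions and the spacing of fractions -/

/-- A nonnegative `C¹` function of integral `1`, vanishing outside `(-r, r)` and bounded by
`1 / r`. -/
structure IsBump (r : ℝ) (φ : ℝ → ℝ) : Prop where
  pos : 0 < r
  contDiff : ContDiff ℝ 1 φ
  nonneg : ∀ x, 0 ≤ φ x
  le : ∀ x, φ x ≤ 1 / r
  eq_zero : ∀ x, r ≤ |x| → φ x = 0
  integral_eq : ∫ x, φ x = 1

lemma exists_isBump {r : ℝ} (hr : 0 < r) : ∃ φ, IsBump r φ := by
  let f : ContDiffBump (0 : ℝ) := ⟨r / 2, r, half_pos hr, half_lt_self hr⟩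
  refine ⟨f.normed volume, hr, f.contDiff_normed (n := 1), f.nonneg_normed, fun x => ?_,
    fun x hx => ?_, f.integral_normed⟩
  · have h := f.normed_le_div_measure_closedBall_rIn volume x
    rw [measureReal_def, Real.volume_closedBall, ENNReal.toReal_ofReal (by simp [f]; linarith)] at h
    have e : 2 * f.rIn = r := by simp only [f]; ring
    rwa [e] at h
  · by_contra hne
    have : x ∈ Function.support (f.normed volume) := hne
    rw [f.support_normed_eq, Metric.mem_ball, Real.dist_eq, sub_zero] at this
    exact absurd this (not_lt.2 hx)

namespace IsBump

variable {r : ℝ} {φ : ℝ → ℝ}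

lemma continuous (h : IsBump r φ) : Continuous φ := h.contDiff.continuous

lemma integrable (h : IsBump r φ) : Integrable φ := by
  refine h.continuous.integrable_of_hasCompactSupport
    (HasCompactSupport.intro (isCompact_Icc (a := -r) (b := r)) fun x hx => h.eq_zero x ?_)
  by_contra! hlt
  exact hx ⟨(abs_lt.1 hlt).1.le, (abs_lt.1 hlt).2.le⟩

lemma continuous_translate (h : IsBump r φ) (c : ℝ) : Continuous fun t => φ (t - c) :=
  h.continuous.comp (continuous_id.sub continuous_const)

lemma integral_nonneg (h : IsBump r φ) {u v : ℝ} (huv : u ≤ v) (c : ℝ) :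
    0 ≤ ∫ t in u..v, φ (t - c) :=
  intervalIntegral.integral_nonneg huv fun _ _ => h.nonneg _

lemma integral_le_one (h : IsBump r φ) {u v : ℝ} (huv : u ≤ v) (c : ℝ) :
    ∫ t in u..v, φ (t - c) ≤ 1 := by
  rw [intervalIntegral.integral_comp_sub_right, intervalIntegral.integral_of_le (by linarith),
    ← h.integral_eq]
  exact setIntegral_le_integral h.integrable (Eventually.of_forall h.nonneg)

lemma integral_le_div (h : IsBump r φ) {u v : ℝ} (huv : u ≤ v) (c : ℝ) :
    ∫ t in u..v, φ (t - c) ≤ (v - u) / r := by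
  calc ∫ t in u..v, φ (t - c) ≤ ∫ _ in u..v, 1 / r :=
        intervalIntegral.integral_mono_on huv ((h.continuous_translate c).intervalIntegrable _ _)
          intervalIntegrable_const fun t _ => h.le _
    _ = (v - u) / r := by rw [intervalIntegral.integral_const, smul_eq_mul]; ring

lemma integral_eq_one (h : IsBump r φ) {u v c : ℝ} (hu : u ≤ c - r) (hv : c + r ≤ v) :
    ∫ t in u..v, φ (t - c) = 1 := by
  have := h.pos
  rw [intervalIntegral.integral_comp_sub_right, intervalIntegral.integral_of_le (by linarith),
    ← h.integral_eq]
  refine setIntegral_eq_integral_of_forall_compl_eq_zero fun x hx => h.eq_zero x ?_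
  by_contra! hlt
  have := abs_lt.1 hlt
  exact hx ⟨by linarith, by linarith⟩

lemma integral_eq_zero (h : IsBump r φ) {u v c : ℝ} (huv : u ≤ v) (hc : v ≤ c - r ∨ c + r ≤ u) :
    ∫ t in u..v, φ (t - c) = 0 := by
  rw [intervalIntegral.integral_congr (g := fun _ => (0 : ℝ)), intervalIntegral.integral_zero]
  intro t ht
  rw [uIcc_of_le huv] at ht
  refine h.eq_zero _ ?_
  rcases hc with hc | hc
  · exact le_abs.2 (Or.inr (by linarith [ht.2]))
  · exact le_abs.2 (Or.inl (by linarith [ht.1]))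

/-- Bumps placed at the fractions `p / q` with `0 < p < q` and weighted by `1 / q` are close to the
uniform distribution on `[0, 1]`. -/
lemma abs_sum_integral_sub_le (h : IsBump r φ) {q : ℕ} (hq : 0 < q) (hrq : r ≤ 1 / q) {x : ℝ}
    (hx0 : 0 ≤ x) (hx1 : x ≤ 1) :
    |((q : ℝ)⁻¹ * ∑ p ∈ Finset.Ioo 0 q, ∫ t in (0 : ℝ)..x, φ (t - (p : ℝ) / q)) - x| ≤ r + 1 / q := by
  have hr := h.pos
  have hq0 : (0 : ℝ) < q := by exact_mod_cast hq
  set I : ℕ → ℝ := fun p => ∫ t in (0 : ℝ)..x, φ (t - (p : ℝ) / q) with hI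
  have hupper : ∑ p ∈ Finset.Ioo 0 q, I p ≤ q * (x + r) := by
    have hsub : (Finset.Ioo 0 q).filter (fun p : ℕ => (p : ℝ) / q < x + r)
        ⊆ Finset.Icc 1 ⌊q * (x + r)⌋₊ := fun p hp => by
      rw [Finset.mem_filter, Finset.mem_Ioo, div_lt_iff₀ hq0] at hp
      exact Finset.mem_Icc.2 ⟨hp.1.1, Nat.le_floor (by linarith [hp.2])⟩
    calc ∑ p ∈ Finset.Ioo 0 q, I p
        = ∑ p ∈ (Finset.Ioo 0 q).filter (fun p : ℕ => (p : ℝ) / q < x + r), I p := by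
          refine (Finset.sum_filter_of_ne fun p _ hne => ?_).symm
          by_contra! hge
          exact hne (h.integral_eq_zero hx0 (Or.inl (by linarith)))
      _ ≤ ∑ p ∈ (Finset.Ioo 0 q).filter (fun p : ℕ => (p : ℝ) / q < x + r), 1 :=
          Finset.sum_le_sum fun p _ => h.integral_le_one hx0 _
      _ ≤ (⌊q * (x + r)⌋₊ : ℝ) := by
          rw [Finset.sum_const, nsmul_eq_mul, mul_one]
          exact_mod_cast (Finset.card_le_card hsub).trans_eq (by simp)
      _ ≤ q * (x + r) := Nat.floor_le (by positivity)
  have hlower : q * (x - r) - 1 ≤ ∑ p ∈ Finset.Ioo 0 q, I p := by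
    rcases lt_or_ge (q * (x - r)) 0 with hneg | hnn
    · have : 0 ≤ ∑ p ∈ Finset.Ioo 0 q, I p :=
        Finset.sum_nonneg fun p _ => h.integral_nonneg hx0 _
      linarith
    have hsub : Finset.Icc 1 ⌊q * (x - r)⌋₊ ⊆ Finset.Ioo 0 q := fun p hp => by
      rw [Finset.mem_Icc] at hp
      refine Finset.mem_Ioo.2 ⟨hp.1, hp.2.trans_lt ((Nat.floor_lt hnn).2 ?_)⟩
      nlinarith
    calc q * (x - r) - 1 ≤ (⌊q * (x - r)⌋₊ : ℝ) := by linarith [Nat.lt_floor_add_one (q * (x - r))]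
      _ = ∑ p ∈ Finset.Icc 1 ⌊q * (x - r)⌋₊, I p := by
          rw [Finset.sum_congr rfl (g := fun _ => (1 : ℝ)) fun p hp => ?_]
          · simp
          · rw [Finset.mem_Icc] at hp
            have hp1 : (1 : ℝ) ≤ p := by exact_mod_cast hp.1
            have hp2 : (p : ℝ) ≤ q * (x - r) := (Nat.le_floor_iff hnn).1 hp.2
            have h1 : 1 / (q : ℝ) ≤ p / q := by gcongr
            have h2 : (p : ℝ) / q ≤ x - r := by rw [div_le_iff₀ hq0]; linarith
            -- `r ≤ 1 / q ≤ p / q` keeps the bump to the right of `0`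
            exact h.integral_eq_one (by linarith) (by linarith)
      _ ≤ _ := Finset.sum_le_sum_of_subset_of_nonneg hsub fun p _ _ => h.integral_nonneg hx0 _
  have e1 : (q : ℝ)⁻¹ * (q * (x + r)) = x + r := by field_simp
  have e2 : (q : ℝ)⁻¹ * (q * (x - r) - 1) = x - r - 1 / q := by field_simp
  have h1 := mul_le_mul_of_nonneg_left hupper (inv_nonneg.2 hq0.le)
  have h2 := mul_le_mul_of_nonneg_left hlower (inv_nonneg.2 hq0.le)
  have h3 : 0 < 1 / (q : ℝ) := by positivity
  rw [e1] at h1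
  rw [e2] at h2
  exact abs_le.2 ⟨by linarith, by linarith⟩

end IsBump

/-- A finite family of `d`-separated points in `[a, b]` has at most `(b - a) / d + 1` members. -/
lemma card_le_of_separated {ι : Type*} (T : Finset ι) (c : ι → ℝ) {a b d : ℝ} (hab : a ≤ b)
    (hd : 0 < d) (hc : ∀ i ∈ T, c i ∈ Icc a b)
    (hsep : ∀ i ∈ T, ∀ j ∈ T, i ≠ j → d ≤ |c i - c j|) : (T.card : ℝ) ≤ (b - a) / d + 1 := by
  have hba : 0 ≤ (b - a) / d := div_nonneg (by linarith) hd.le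
  have hcard : T.card ≤ (Finset.range (⌊(b - a) / d⌋₊ + 1)).card := by
    refine Finset.card_le_card_of_injOn (fun i => ⌊(c i - a) / d⌋₊) (fun i hi => ?_) ?_
    · have : (c i - a) / d ≤ (b - a) / d := by gcongr; exact (hc i hi).2
      simpa using Nat.lt_succ_of_le (Nat.floor_le_floor this)
    · intro i hi j hj hij
      by_contra hne
      have h1 := hsep i hi j hj hne
      have ni : 0 ≤ (c i - a) / d := div_nonneg (by linarith [(hc i hi).1]) hd.le
      have nj : 0 ≤ (c j - a) / d := div_nonneg (by linarith [(hc j hj).1]) hd.le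
      have hij' : (⌊(c i - a) / d⌋₊ : ℝ) = ⌊(c j - a) / d⌋₊ := by exact_mod_cast hij
      have h2 : |(c i - a) / d - (c j - a) / d| < 1 := by
        rw [abs_lt]
        constructor <;> linarith [Nat.floor_le ni, Nat.floor_le nj,
          Nat.lt_floor_add_one ((c i - a) / d), Nat.lt_floor_add_one ((c j - a) / d)]
      rw [← sub_div, sub_sub_sub_cancel_right, abs_div, abs_of_pos hd, div_lt_one hd] at h2
      linarith
  rw [Finset.card_range] at hcard
  calc (T.card : ℝ) ≤ ((⌊(b - a) / d⌋₊ + 1 : ℕ) : ℝ) := by exact_mod_cast hcard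
    _ ≤ _ := by push_cast; linarith [Nat.floor_le hba]

/-- Distinct fractions `p / q` with `q ≤ m` prime and `0 < p < q` are `1 / m²`-separated. -/
lemma abs_div_sub_div_ge {m q q' p p' : ℕ} (hq : q.Prime) (hq' : q'.Prime) (hqm : q ≤ m)
    (hqm' : q' ≤ m) (hp : p ∈ Finset.Ioo 0 q) (hp' : p' ∈ Finset.Ioo 0 q')
    (hne : (q, p) ≠ (q', p')) : 1 / (m : ℝ) ^ 2 ≤ |(p : ℝ) / q - (p' : ℝ) / q'| := by
  rw [Finset.mem_Ioo] at hp hp'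
  have hcross : p * q' ≠ p' * q := by
    intro he
    by_cases hqq : q = q'
    · subst hqq
      exact hne (by rw [Nat.eq_of_mul_eq_mul_right hq.pos he])
    · have hdvd : q ∣ p * q' := he ▸ dvd_mul_left q p'
      rcases (hq.dvd_mul).1 hdvd with h | h
      · exact absurd (Nat.le_of_dvd hp.1 h) (by omega)
      · exact hqq ((Nat.prime_dvd_prime_iff_eq hq hq').1 h)
  have h1 : (1 : ℝ) ≤ |(p : ℝ) * q' - p' * q| := by
    have h2 : (p : ℤ) * q' - p' * q ≠ 0 := fun h0 => hcross (by
      have := sub_eq_zero.1 h0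
      exact_mod_cast this)
    exact_mod_cast Int.one_le_abs h2
  have hq0 : (0 : ℝ) < q := by exact_mod_cast hq.pos
  have hq0' : (0 : ℝ) < q' := by exact_mod_cast hq'.pos
  rw [div_sub_div _ _ hq0.ne' hq0'.ne', abs_div, abs_of_pos (mul_pos hq0 hq0'), mul_comm (q : ℝ) p']
  have hm : (q : ℝ) * q' ≤ (m : ℝ) ^ 2 := by
    rw [sq]; gcongr
  exact div_le_div₀ (abs_nonneg _) h1 (mul_pos hq0 hq0') hm

/-! ### The kernel concentrated near fractions with prime denominator -/

/-- The average over `q ∈ Q` of the densities that put mass `1 / q`, in the shape of the bump `φ`,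
at each fraction `p / q` with `0 < p < q`. -/
noncomputable def ratKernel (Q : Finset ℕ) (φ : ℝ → ℝ) (x : ℝ) : ℝ :=
  (Q.card : ℝ)⁻¹ * ∑ q ∈ Q, (q : ℝ)⁻¹ * ∑ p ∈ Finset.Ioo 0 q, φ (x - (p : ℝ) / q)

section ratKernel

variable {r : ℝ} {φ : ℝ → ℝ} {Q : Finset ℕ}

lemma contDiff_ratKernel (h : IsBump r φ) : ContDiff ℝ 1 (ratKernel Q φ) :=
  contDiff_const.mul <| ContDiff.sum fun _ _ => contDiff_const.mul <| ContDiff.sum fun _ _ =>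
    h.contDiff.comp (contDiff_id.sub contDiff_const)

lemma ratKernel_nonneg (h : IsBump r φ) (x : ℝ) : 0 ≤ ratKernel Q φ x :=
  mul_nonneg (by positivity) <| Finset.sum_nonneg fun _ _ => mul_nonneg (by positivity) <|
    Finset.sum_nonneg fun _ _ => h.nonneg _

lemma tsupport_ratKernel_subset (h : IsBump r φ) :
    tsupport (ratKernel Q φ) ⊆ {x | ∃ q ∈ Q, ∃ p ∈ Finset.Ioo 0 q, |x - (p : ℝ) / q| ≤ r} := by
  have hset : {x : ℝ | ∃ q ∈ Q, ∃ p ∈ Finset.Ioo 0 q, |x - (p : ℝ) / q| ≤ r}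
      = ⋃ q ∈ Q, ⋃ p ∈ Finset.Ioo 0 q, {x : ℝ | |x - (p : ℝ) / q| ≤ r} := by
    ext x
    simp only [mem_iUnion, exists_prop]
    rfl
  refine closure_minimal (fun x hx => ?_) ?_
  · by_contra! hno
    simp only [Set.mem_ofPred_eq, not_exists, not_and, not_le] at hno
    refine hx ?_
    rw [ratKernel, Finset.sum_eq_zero, mul_zero]
    intro q hq
    rw [Finset.sum_eq_zero, mul_zero]
    exact fun p hp => h.eq_zero _ (hno q hq p hp).le
  · rw [hset]
    exact isClosed_biUnion_finset fun q _ => isClosed_biUnion_finset fun p _ =>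
      isClosed_le (by fun_prop) continuous_const

lemma integral_ratKernel (h : IsBump r φ) (u v : ℝ) :
    ∫ t in u..v, ratKernel Q φ t =
      (Q.card : ℝ)⁻¹ * ∑ q ∈ Q, (q : ℝ)⁻¹ * ∑ p ∈ Finset.Ioo 0 q,
        ∫ t in u..v, φ (t - (p : ℝ) / q) := by
  have hi : ∀ c : ℝ, IntervalIntegrable (fun t => φ (t - c)) volume u v := fun c =>
    (h.continuous_translate c).intervalIntegrable _ _
  simp only [ratKernel]
  rw [intervalIntegral.integral_const_mul, intervalIntegral.integral_finsetSum]
  · congr 1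
    refine Finset.sum_congr rfl fun q _ => ?_
    rw [intervalIntegral.integral_const_mul, intervalIntegral.integral_finsetSum]
    exact fun p _ => hi _
  · exact fun q _ => Continuous.intervalIntegrable
      (continuous_const.mul (continuous_finsetSum _ fun p _ => h.continuous_translate _)) _ _

/-- The kernel is close to the uniform distribution on `[0, 1]`. -/
lemma abs_integral_ratKernel_sub_le (h : IsBump r φ) {n : ℕ} (hn : 0 < n) (hQ : Q.Nonempty)
    (hnQ : ∀ q ∈ Q, n ≤ q) (hrQ : ∀ q ∈ Q, r ≤ 1 / q) {x : ℝ} (hx0 : 0 ≤ x) (hx1 : x ≤ 1) :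
    |(∫ t in (0 : ℝ)..x, ratKernel Q φ t) - x| ≤ r + 1 / n := by
  have hn0 : (0 : ℝ) < n := by exact_mod_cast hn
  have hN : (0 : ℝ) < Q.card := by exact_mod_cast hQ.card_pos
  set S : ℕ → ℝ := fun q => (q : ℝ)⁻¹ * ∑ p ∈ Finset.Ioo 0 q,
    ∫ t in (0 : ℝ)..x, φ (t - (p : ℝ) / q) with hS
  have hq : ∀ q ∈ Q, |S q - x| ≤ r + 1 / n := fun q hq => by
    have hnq := hnQ q hq
    refine (h.abs_sum_integral_sub_le (hn.trans_le hnq) (hrQ q hq) hx0 hx1).trans ?_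
    gcongr
  have e : (Q.card : ℝ)⁻¹ * ∑ q ∈ Q, S q - x = (Q.card : ℝ)⁻¹ * ∑ q ∈ Q, (S q - x) := by
    rw [Finset.sum_sub_distrib, Finset.sum_const, nsmul_eq_mul]
    field_simp
  rw [integral_ratKernel h, e, abs_mul, abs_of_pos (inv_pos.2 hN), inv_mul_le_iff₀ hN]
  calc |∑ q ∈ Q, (S q - x)| ≤ ∑ q ∈ Q, |S q - x| := Finset.abs_sum_le_sum_abs _ _
    _ ≤ ∑ q ∈ Q, (r + 1 / n) := Finset.sum_le_sum hq
    _ = Q.card * (r + 1 / n) := by rw [Finset.sum_const, nsmul_eq_mul]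

/-- Small intervals: since distinct fractions `p / q` with `q ∈ (n, 2n]` prime are
`1 / (4 n²)`-separated, an interval meets few of the bumps. -/
lemma integral_ratKernel_le (h : IsBump r φ) {n : ℕ} (hn : 0 < n)
    (hQ : Q ⊆ (Finset.Ioc n (2 * n)).filter Nat.Prime) {u v B : ℝ} (huv : u ≤ v)
    (hB : ∀ c, ∫ t in u..v, φ (t - c) ≤ B) :
    ∫ t in u..v, ratKernel Q φ t ≤ (4 * n ^ 2 * (v - u + 2 * r) + 1) * B / (Q.card * n) := by
  have hr := h.pos
  have hn0 : (0 : ℝ) < n := by exact_mod_cast hn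
  have hB0 : 0 ≤ B := (h.integral_nonneg huv 0).trans (hB 0)
  set T : Finset (Σ _ : ℕ, ℕ) := Q.sigma fun q => Finset.Ioo 0 q with hT
  set c : (Σ _ : ℕ, ℕ) → ℝ := fun i => (i.2 : ℝ) / i.1 with hc
  set T' := T.filter fun i => u - r ≤ c i ∧ c i ≤ v + r with hT'
  have hcard : (T'.card : ℝ) ≤ 4 * n ^ 2 * (v - u + 2 * r) + 1 := by
    have := card_le_of_separated T' c (a := u - r) (b := v + r) (d := 1 / ((2 * n : ℕ) : ℝ) ^ 2)
      (by linarith) (by positivity) (fun i hi => (Finset.mem_filter.1 hi).2) ?_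
    · refine this.trans_eq ?_
      push_cast
      field_simp
      ring
    · rintro ⟨q, p⟩ hi ⟨q', p'⟩ hj hne
      have hi1 := Finset.mem_sigma.1 (Finset.mem_filter.1 hi).1
      have hj1 := Finset.mem_sigma.1 (Finset.mem_filter.1 hj).1
      have hq := Finset.mem_filter.1 (hQ hi1.1)
      have hq' := Finset.mem_filter.1 (hQ hj1.1)
      refine abs_div_sub_div_ge hq.2 hq'.2 (Finset.mem_Ioc.1 hq.1).2 (Finset.mem_Ioc.1 hq'.1).2
        hi1.2 hj1.2 fun he => hne ?_
      rw [Prod.mk.injEq] at he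
      obtain ⟨rfl, rfl⟩ := he
      rfl
  have hsum : ∑ q ∈ Q, ∑ p ∈ Finset.Ioo 0 q, ∫ t in u..v, φ (t - (p : ℝ) / q)
      ≤ (4 * n ^ 2 * (v - u + 2 * r) + 1) * B := by
    calc ∑ q ∈ Q, ∑ p ∈ Finset.Ioo 0 q, ∫ t in u..v, φ (t - (p : ℝ) / q)
        = ∑ i ∈ T, ∫ t in u..v, φ (t - c i) := by rw [hT, Finset.sum_sigma]
      _ = ∑ i ∈ T', ∫ t in u..v, φ (t - c i) := by
          refine (Finset.sum_filter_of_ne fun i _ hne => ?_).symm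
          by_contra hno
          refine hne (h.integral_eq_zero huv ?_)
          rcases not_and_or.1 hno with h1 | h1
          · exact Or.inr (by linarith [not_le.1 h1])
          · exact Or.inl (by linarith [not_le.1 h1])
      _ ≤ ∑ _i ∈ T', B := Finset.sum_le_sum fun i _ => hB _
      _ = T'.card * B := by rw [Finset.sum_const, nsmul_eq_mul]
      _ ≤ _ := mul_le_mul_of_nonneg_right hcard hB0
  rw [integral_ratKernel h]
  calc (Q.card : ℝ)⁻¹ * ∑ q ∈ Q, (q : ℝ)⁻¹ * ∑ p ∈ Finset.Ioo 0 q, ∫ t in u..v, φ (t - (p : ℝ) / q)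
      ≤ (Q.card : ℝ)⁻¹ * ∑ q ∈ Q, (n : ℝ)⁻¹ *
          ∑ p ∈ Finset.Ioo 0 q, ∫ t in u..v, φ (t - (p : ℝ) / q) := by
        gcongr with q hq
        · exact Finset.sum_nonneg fun p _ => h.integral_nonneg huv _
        · exact (Finset.mem_Ioc.1 (Finset.mem_filter.1 (hQ hq)).1).1.le
    _ = (∑ q ∈ Q, ∑ p ∈ Finset.Ioo 0 q, ∫ t in u..v, φ (t - (p : ℝ) / q)) / (Q.card * n) := by
        rw [← Finset.mul_sum, div_eq_mul_inv, mul_inv]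
        ring
    _ ≤ _ := by gcongr

end ratKernel

/-- The bump radius used for denominators in `(n, 2n]` is at most `1 / (8 n²)`. -/
lemma half_rpow_neg_le {τ : ℝ} (hτ : 2 ≤ τ) {n : ℕ} (hn : 0 < n) :
    (2 * n : ℝ) ^ (-τ) / 2 ≤ 1 / (8 * n ^ 2) := by
  have hn1 : (1 : ℝ) ≤ n := by exact_mod_cast hn
  have h1 : (2 * n : ℝ) ^ (-τ) ≤ (2 * n : ℝ) ^ (-(2 : ℝ)) :=
    Real.rpow_le_rpow_of_exponent_le (by linarith) (by linarith)
  have h2 : (2 * n : ℝ) ^ (-(2 : ℝ)) = 1 / (4 * n ^ 2) := by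
    rw [Real.rpow_neg (by positivity), Real.rpow_two]
    field_simp
    norm_num
  rw [h2] at h1
  have h3 : 1 / (8 * (n : ℝ) ^ 2) = 1 / (4 * n ^ 2) / 2 := by field_simp; norm_num
  rw [h3]
  linarith

lemma abs_integral_ratKernel_sub_le_two_div {τ : ℝ} (hτ : 2 ≤ τ) {n : ℕ} (hn : 0 < n) {φ : ℝ → ℝ}
    (h : IsBump ((2 * n : ℝ) ^ (-τ) / 2) φ) {Q : Finset ℕ} (hQ : Q.Nonempty)
    (hQn : Q ⊆ Finset.Ioc n (2 * n)) {x : ℝ} (hx0 : 0 ≤ x) (hx1 : x ≤ 1) :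
    |(∫ t in (0 : ℝ)..x, ratKernel Q φ t) - x| ≤ 2 / n := by
  have hn1 : (1 : ℝ) ≤ n := by exact_mod_cast hn
  have hr := half_rpow_neg_le hτ hn
  have h1 : 1 / (8 * (n : ℝ) ^ 2) ≤ 1 / (2 * n) := by
    apply one_div_le_one_div_of_le <;> nlinarith
  have h2 : 1 / (2 * (n : ℝ)) ≤ 1 / n := by
    apply one_div_le_one_div_of_le <;> linarith
  refine (abs_integral_ratKernel_sub_le h hn hQ (fun q hq => (Finset.mem_Ioc.1 (hQn hq)).1.le)
    (fun q hq => (hr.trans h1).trans ?_) hx0 hx1).trans ?_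
  · have hq2 := Finset.mem_Ioc.1 (hQn hq)
    have h3 : (q : ℝ) ≤ 2 * n := by exact_mod_cast hq2.2
    have h4 : (0 : ℝ) < q := by exact_mod_cast hn.trans hq2.1
    exact one_div_le_one_div_of_le h4 h3
  · have : 2 / (n : ℝ) = 1 / n + 1 / n := by ring
    linarith

/-- The kernel built from many primes in `(n, 2n]` and bumps of radius `(2n) ^ (-τ) / 2` satisfies
a Hölder condition of exponent `σ` with a constant independent of `n`. The three ranges of
`v - u` are separated by `1 / n`, the spacing of fractions with a fixed denominator, and `1 / n²`,
the spacing of all the fractions. -/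
lemma integral_ratKernel_le_rpow {τ ε σ : ℝ} (hτ : 2 ≤ τ) (hσ : 0 < σ) (hσε : σ ≤ 1 - ε)
    (hε : 0 < ε) (hτσ : τ * σ ≤ 2 - ε) {n : ℕ} (hn : 0 < n) {φ : ℝ → ℝ}
    (h : IsBump ((2 * n : ℝ) ^ (-τ) / 2) φ)
    (hN : (n : ℝ) ^ (1 - ε) ≤ ((Finset.Ioc n (2 * n)).filter Nat.Prime).card)
    {u v : ℝ} (hu : 0 ≤ u) (huv : u ≤ v) (hv : v ≤ 1) :
    ∫ t in u..v, ratKernel ((Finset.Ioc n (2 * n)).filter Nat.Prime) φ t ≤ 48 * (v - u) ^ σ := by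
  set Q := (Finset.Ioc n (2 * n)).filter Nat.Prime with hQ
  set r := (2 * n : ℝ) ^ (-τ) / 2 with hr
  have hr0 := h.pos
  have hn1 : (1 : ℝ) ≤ n := by exact_mod_cast hn
  have hn0 : (0 : ℝ) < n := by linarith
  have hr8 : r ≤ 1 / (8 * n ^ 2) := half_rpow_neg_le hτ hn
  have hrn : 8 * n ^ 2 * r ≤ 1 := by rwa [le_div_iff₀ (by positivity), mul_comm] at hr8
  have hpow0 : (0 : ℝ) < (n : ℝ) ^ (2 - ε) := by positivity
  have hcard0 : (0 : ℝ) < Q.card := (Real.rpow_pos_of_pos hn0 _).trans_le hN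
  have hQne : Q.Nonempty := Finset.card_pos.1 (by exact_mod_cast hcard0)
  have hden : (n : ℝ) ^ (2 - ε) ≤ Q.card * n := by
    rw [show 2 - ε = 1 - ε + 1 by ring, Real.rpow_add hn0, Real.rpow_one]
    gcongr
  rcases huv.eq_or_lt with rfl | huv'
  · rw [intervalIntegral.integral_same]
    positivity
  obtain ⟨l, hl⟩ : ∃ l, l = v - u := ⟨_, rfl⟩
  have hl0 : 0 < l := by linarith
  have hl1 : l ≤ 1 := by linarith
  -- the general bound, with the crude estimates for radius and number of primes inserted
  have hgen : ∀ B, (∀ c, ∫ t in u..v, φ (t - c) ≤ B) →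
      ∫ t in u..v, ratKernel Q φ t ≤ (4 * n ^ 2 * l + 2) * B / (n : ℝ) ^ (2 - ε) := by
    intro B hB
    have hB0 : 0 ≤ B := (h.integral_nonneg huv 0).trans (hB 0)
    refine (integral_ratKernel_le h hn subset_rfl huv hB).trans ?_
    rw [← hl]
    have : 4 * (n : ℝ) ^ 2 * (l + 2 * r) + 1 ≤ 4 * n ^ 2 * l + 2 := by linarith
    gcongr
  rw [← hl]
  rcases le_or_gt (1 / (n : ℝ)) l with hA | hA
  · have h1 := abs_le.1 (abs_integral_ratKernel_sub_le_two_div hτ hn h hQne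
      (Finset.filter_subset _ _) hu (huv.trans hv))
    have h2 := abs_le.1 (abs_integral_ratKernel_sub_le_two_div hτ hn h hQne
      (Finset.filter_subset _ _) (hu.trans huv) hv)
    have hc : Continuous (ratKernel Q φ) := (contDiff_ratKernel h).continuous
    have h3 := intervalIntegral.integral_add_adjacent_intervals
      (hc.intervalIntegrable (μ := volume) 0 u) (hc.intervalIntegrable u v)
    have h4 : 2 / (n : ℝ) = 2 * (1 / n) := by ring
    have h5 : l ≤ l ^ σ := by
      simpa using Real.rpow_le_rpow_of_exponent_ge hl0 hl1 (show σ ≤ 1 by linarith)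
    linarith [h1.1, h2.2]
  rcases le_or_gt (1 / (n : ℝ) ^ 2) l with hB | hB
  · have h1 := hgen 1 (h.integral_le_one huv)
    have h2 : 1 ≤ l * n ^ 2 := by rwa [div_le_iff₀ (by positivity)] at hB
    have h3 : (n : ℝ) ^ ε ≤ l ^ (-ε) := by
      rw [Real.rpow_neg hl0.le, ← Real.inv_rpow hl0.le]
      refine Real.rpow_le_rpow hn0.le ?_ hε.le
      rw [le_inv_comm₀ hn0 hl0]
      simpa using hA.le
    have h4 : l ^ (1 - ε) ≤ l ^ σ := Real.rpow_le_rpow_of_exponent_ge hl0 hl1 hσε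
    calc ∫ t in u..v, ratKernel Q φ t ≤ (4 * n ^ 2 * l + 2) * 1 / (n : ℝ) ^ (2 - ε) := h1
      _ ≤ 6 * (l * n ^ 2) / (n : ℝ) ^ (2 - ε) := by
          refine div_le_div_of_nonneg_right ?_ hpow0.le
          linarith
      _ = 6 * (l * (n : ℝ) ^ ε) := by
          rw [Real.rpow_sub hn0, Real.rpow_two]
          field_simp
      _ ≤ 6 * (l * l ^ (-ε)) := by gcongr
      _ = 6 * l ^ (1 - ε) := by rw [sub_eq_add_neg, Real.rpow_add hl0, Real.rpow_one]
      _ ≤ 48 * l ^ σ := by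
          have : 0 < l ^ σ := by positivity
          linarith
  · have hlr : 0 < l / r := by positivity
    have h1 := hgen ((l / r) ^ σ) fun c => by
      rcases le_total (l / r) 1 with hle | hge
      · refine (h.integral_le_div huv c).trans ?_
        rw [← hl]
        simpa using Real.rpow_le_rpow_of_exponent_ge hlr hle (show σ ≤ 1 by linarith)
      · exact (h.integral_le_one huv c).trans (Real.one_le_rpow hge hσ.le)
    have h2 : l * n ^ 2 < 1 := by rwa [lt_div_iff₀ (by positivity)] at hB
    have h3 : (l / r) ^ σ ≤ l ^ σ * (8 * (n : ℝ) ^ (2 - ε)) := by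
      have e : l / r = l * (2 * (2 * n : ℝ) ^ τ) := by
        rw [hr, Real.rpow_neg (by positivity)]
        field_simp
      rw [e, Real.mul_rpow hl0.le (by positivity), Real.mul_rpow zero_le_two (by positivity),
        ← Real.rpow_mul (by positivity)]
      have h4 : (2 : ℝ) ^ σ ≤ 2 := by
        simpa using Real.rpow_le_rpow_of_exponent_le one_le_two (show σ ≤ 1 by linarith)
      have h5 : (2 * n : ℝ) ^ (τ * σ) ≤ 4 * (n : ℝ) ^ (2 - ε) := by
        calc (2 * n : ℝ) ^ (τ * σ) ≤ (2 * n : ℝ) ^ (2 - ε) :=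
              Real.rpow_le_rpow_of_exponent_le (by linarith) hτσ
          _ = 2 ^ (2 - ε) * (n : ℝ) ^ (2 - ε) := Real.mul_rpow zero_le_two hn0.le
          _ ≤ 4 * (n : ℝ) ^ (2 - ε) := by
              gcongr
              calc (2 : ℝ) ^ (2 - ε) ≤ (2 : ℝ) ^ (2 : ℝ) :=
                    Real.rpow_le_rpow_of_exponent_le one_le_two (by linarith)
                _ = 4 := by norm_num
      calc l ^ σ * ((2 : ℝ) ^ σ * (2 * n : ℝ) ^ (τ * σ))
          ≤ l ^ σ * (2 * (4 * (n : ℝ) ^ (2 - ε))) := by gcongr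
        _ = _ := by ring
    calc ∫ t in u..v, ratKernel Q φ t ≤ (4 * n ^ 2 * l + 2) * (l / r) ^ σ / (n : ℝ) ^ (2 - ε) := h1
      _ ≤ 6 * (l ^ σ * (8 * (n : ℝ) ^ (2 - ε))) / (n : ℝ) ^ (2 - ε) := by
          gcongr
          linarith
      _ = 48 * l ^ σ := by field_simp; norm_num

/-! ### The refinement step -/

/-- Multiplying a `C¹` density by a nearly equidistributed density `g` hardly changes the mass of
intervals, by integration by parts against the discrepancy `∫₀ˣ g - x`. -/
lemma abs_integral_mul_sub_le {f g : ℝ → ℝ} (hf : ContDiff ℝ 1 f) (hg : Continuous g) {M L η : ℝ}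
    (hM : ∀ x ∈ Icc (0 : ℝ) 1, |f x| ≤ M) (hL : ∀ x ∈ Icc (0 : ℝ) 1, |deriv f x| ≤ L)
    (hη : ∀ x ∈ Icc (0 : ℝ) 1, |(∫ t in (0 : ℝ)..x, g t) - x| ≤ η)
    {u v : ℝ} (hu : 0 ≤ u) (huv : u ≤ v) (hv : v ≤ 1) :
    |(∫ t in u..v, f t * g t) - ∫ t in u..v, f t| ≤ (2 * M + L) * η := by
  have h0 : (0 : ℝ) ∈ Icc (0 : ℝ) 1 := ⟨le_rfl, zero_le_one⟩
  have hM0 : 0 ≤ M := (abs_nonneg _).trans (hM 0 h0)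
  have hL0 : 0 ≤ L := (abs_nonneg _).trans (hL 0 h0)
  have hη0 : 0 ≤ η := (abs_nonneg _).trans (hη 0 h0)
  have hum : u ∈ Icc (0 : ℝ) 1 := ⟨hu, huv.trans hv⟩
  have hvm : v ∈ Icc (0 : ℝ) 1 := ⟨hu.trans huv, hv⟩
  set W : ℝ → ℝ := fun x => (∫ t in (0 : ℝ)..x, g t) - x with hW
  have hWd : ∀ x, HasDerivAt W (g x - 1) x := fun x =>
    (intervalIntegral.integral_hasDerivAt_right (hg.intervalIntegrable _ _)
      hg.aestronglyMeasurable.stronglyMeasurableAtFilter hg.continuousAt).sub (hasDerivAt_id x)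
  have hf' : Continuous (deriv f) := hf.continuous_deriv le_rfl
  have hparts := intervalIntegral.integral_mul_deriv_eq_deriv_mul (a := u) (b := v)
    (fun x _ => (hf.differentiable one_ne_zero x).hasDerivAt) (fun x _ => hWd x)
    (hf'.intervalIntegrable _ _) ((hg.sub continuous_const).intervalIntegrable _ _)
  have hlhs : (∫ t in u..v, f t * g t) - ∫ t in u..v, f t = ∫ t in u..v, f t * (g t - 1) := by
    rw [← intervalIntegral.integral_sub (f := fun t => f t * g t)
      ((hf.continuous.mul hg).intervalIntegrable _ _) (hf.continuous.intervalIntegrable _ _)]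
    exact intervalIntegral.integral_congr fun t _ => by ring
  have hI : |∫ t in u..v, deriv f t * W t| ≤ L * η := by
    have h1 := intervalIntegral.norm_integral_le_of_norm_le_const (a := u) (b := v)
      (f := fun t => deriv f t * W t) (C := L * η) fun t ht => by
        rw [uIoc_of_le huv] at ht
        have htm : t ∈ Icc (0 : ℝ) 1 := ⟨hu.trans ht.1.le, ht.2.trans hv⟩
        rw [Real.norm_eq_abs, abs_mul]
        exact mul_le_mul (hL t htm) (hη t htm) (abs_nonneg _) hL0
    rw [Real.norm_eq_abs, abs_of_nonneg (sub_nonneg.2 huv)] at h1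
    have h2 : v - u ≤ 1 := by linarith
    exact h1.trans (mul_le_of_le_one_right (by positivity) h2)
  have hb : ∀ x ∈ Icc (0 : ℝ) 1, |f x * W x| ≤ M * η := fun x hx => by
    rw [abs_mul]
    exact mul_le_mul (hM x hx) (hη x hx) (abs_nonneg _) hM0
  rw [hlhs, hparts]
  have h1 := abs_le.1 (hb u hum)
  have h2 := abs_le.1 (hb v hvm)
  have h3 := abs_le.1 hI
  exact abs_le.2 ⟨by linarith [h1.2, h2.1, h3.2], by linarith [h1.1, h2.2, h3.1]⟩

/-- The masses that `f` gives to the subintervals of `[0, 1]` satisfy a Hölder condition of exponent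
`s` with constant `C`. -/
def HolderMass (s C : ℝ) (f : ℝ → ℝ) : Prop :=
  ∀ u v : ℝ, 0 ≤ u → u ≤ v → v ≤ 1 → ∫ t in u..v, f t ≤ C * (v - u) ^ s

/-- The refinement step: a density with Hölder masses can be concentrated on well approximable
points at the cost of an arbitrarily small loss. Long intervals are controlled by
equidistribution of the kernel, short ones by its own Hölder condition, whose exponent `σ` lies
strictly between `s` and `2 / τ` and so absorbs the bound `M` of `f`. -/
lemma exists_refinement {τ s : ℝ} (hτ : 2 ≤ τ) (hs : 0 < s) (hsτ : s < 2 / τ) {f : ℝ → ℝ}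
    (hf : ContDiff ℝ 1 f) (hf0 : ∀ x, 0 ≤ f x) {C : ℝ} (hC : 0 < C) (hfC : HolderMass s C f)
    {η : ℝ} (hη : 0 < η) (N : ℕ) :
    ∃ f' : ℝ → ℝ, ContDiff ℝ 1 f' ∧ (∀ x, 0 ≤ f' x) ∧ tsupport f' ⊆ tsupport f ∧
      (∀ x ∈ tsupport f', ∃ q p : ℕ, N ≤ q ∧ 0 < p ∧ p < q ∧
        |x - (p : ℝ) / q| < 1 / (q : ℝ) ^ τ) ∧
      HolderMass s (C + η) f' ∧
      ∀ x ∈ Icc (0 : ℝ) 1, |(∫ t in (0 : ℝ)..x, f' t) - ∫ t in (0 : ℝ)..x, f t| ≤ η := by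
  have hτ0 : 0 < τ := by linarith
  have hsτ' : s * τ < 2 := (lt_div_iff₀ hτ0).1 hsτ
  have hsτ0 : 0 < s * τ := by positivity
  -- `ε` makes `σ` the midpoint of `s` and `2 / τ`
  obtain ⟨ε, hε⟩ : ∃ ε, ε = (2 - s * τ) / 4 := ⟨_, rfl⟩
  obtain ⟨σ, hσ⟩ : ∃ σ, σ = (2 - 2 * ε) / τ := ⟨_, rfl⟩
  have hε0 : 0 < ε := by linarith
  have hτσ : τ * σ = 2 - 2 * ε := by rw [hσ]; field_simp
  have hσε : σ ≤ 1 - ε := by rw [hσ, div_le_iff₀ hτ0]; nlinarith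
  have hsσ : s < σ := by rw [hσ, lt_div_iff₀ hτ0]; linarith
  have hf' : Continuous (deriv f) := hf.continuous_deriv le_rfl
  obtain ⟨M₀, hM₀⟩ := isCompact_Icc.exists_bound_of_continuousOn
    (s := Icc (0 : ℝ) 1) hf.continuous.continuousOn
  obtain ⟨L, hL⟩ := isCompact_Icc.exists_bound_of_continuousOn
    (s := Icc (0 : ℝ) 1) hf'.continuousOn
  simp only [Real.norm_eq_abs] at hM₀ hL
  obtain ⟨M, hMdef⟩ : ∃ M, M = max M₀ 1 := ⟨_, rfl⟩
  have hM0 : 0 < M := hMdef ▸ lt_max_of_lt_right one_pos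
  have hM : ∀ x ∈ Icc (0 : ℝ) 1, |f x| ≤ M := fun x hx =>
    (hM₀ x hx).trans (hMdef ▸ le_max_left _ _)
  have hL0 : 0 ≤ L := (abs_nonneg _).trans (hL 0 ⟨le_rfl, zero_le_one⟩)
  -- the threshold between short and long intervals
  obtain ⟨δ, hδ0, hδ1, hδ⟩ : ∃ δ : ℝ, 0 < δ ∧ δ ≤ 1 ∧ M * (48 * δ ^ (σ - s)) ≤ C := by
    have ha : 0 < σ - s := by linarith
    have hK : 0 < C / (48 * M) := by positivity
    refine ⟨min 1 ((C / (48 * M)) ^ (σ - s)⁻¹), lt_min one_pos (by positivity), min_le_left _ _, ?_⟩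
    have h1 : (min 1 ((C / (48 * M)) ^ (σ - s)⁻¹)) ^ (σ - s) ≤ C / (48 * M) := by
      calc _ ≤ ((C / (48 * M)) ^ (σ - s)⁻¹) ^ (σ - s) :=
            Real.rpow_le_rpow (le_min zero_le_one (by positivity)) (min_le_right _ _) ha.le
        _ = C / (48 * M) := Real.rpow_inv_rpow hK.le ha.ne'
    rw [le_div_iff₀ (by positivity)] at h1
    linarith
  have hδs : 0 < δ ^ s := by positivity
  obtain ⟨n, hn, hprimes⟩ :=
    exists_many_primes hε0 (max (max N 1) ⌈(2 * M + L) * 2 / (η * δ ^ s)⌉₊)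
  have hn1 : 0 < n := ((le_max_right N 1).trans (le_max_left _ _)).trans hn
  have hnN : N ≤ n := ((le_max_left N 1).trans (le_max_left _ _)).trans hn
  have hnr : (0 : ℝ) < n := by exact_mod_cast hn1
  have hsmall : (2 * M + L) * (2 / n) ≤ η * δ ^ s := by
    have h1 : (2 * M + L) * 2 / (η * δ ^ s) ≤ n :=
      (Nat.le_ceil _).trans (by exact_mod_cast (le_max_right _ _).trans hn)
    rw [div_le_iff₀ (by positivity)] at h1
    rw [← mul_div_assoc, div_le_iff₀ hnr]
    linarith
  obtain ⟨φ, hφ⟩ := exists_isBump (r := (2 * n : ℝ) ^ (-τ) / 2) (by positivity)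
  set Q := (Finset.Ioc n (2 * n)).filter Nat.Prime with hQ
  have hQne : Q.Nonempty := Finset.card_pos.1 (by
    exact_mod_cast (Real.rpow_pos_of_pos hnr _).trans_le hprimes)
  set g := ratKernel Q φ with hg
  have hgC : ContDiff ℝ 1 g := contDiff_ratKernel hφ
  have hg0 : ∀ x, 0 ≤ g x := ratKernel_nonneg hφ
  have hdisc : ∀ {u v : ℝ}, 0 ≤ u → u ≤ v → v ≤ 1 →
      |(∫ t in u..v, f t * g t) - ∫ t in u..v, f t| ≤ η * δ ^ s := fun hu huv hv =>
    (abs_integral_mul_sub_le hf hgC.continuous hM hL (fun x hx =>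
      abs_integral_ratKernel_sub_le_two_div hτ hn1 hφ hQne (Finset.filter_subset _ _) hx.1 hx.2)
      hu huv hv).trans hsmall
  refine ⟨fun x => f x * g x, hf.mul hgC, fun x => mul_nonneg (hf0 x) (hg0 x),
    tsupport_mul_subset_left, fun x hx => ?_, fun u v hu huv hv => ?_, fun x hx => ?_⟩
  · obtain ⟨q, hq, p, hp, hxp⟩ := tsupport_ratKernel_subset hφ (tsupport_mul_subset_right hx)
    have hq' := Finset.mem_Ioc.1 (Finset.mem_filter.1 hq).1
    rw [Finset.mem_Ioo] at hp
    refine ⟨q, p, hnN.trans hq'.1.le, hp.1, hp.2, hxp.trans_lt ?_⟩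
    have hq0 : (0 : ℝ) < q := by exact_mod_cast hn1.trans hq'.1
    have hq2 : (q : ℝ) ≤ 2 * n := by exact_mod_cast hq'.2
    calc (2 * n : ℝ) ^ (-τ) / 2 < (2 * n : ℝ) ^ (-τ) := half_lt_self (by positivity)
      _ = 1 / (2 * n : ℝ) ^ τ := by rw [Real.rpow_neg (by positivity), one_div]
      _ ≤ 1 / (q : ℝ) ^ τ := by gcongr
  · have hl0 : 0 ≤ v - u := by linarith
    have hls : 0 ≤ (v - u) ^ s := by positivity
    rcases le_or_gt (v - u) δ with hle | hgt
    · calc ∫ t in u..v, f t * g t ≤ ∫ t in u..v, M * g t := by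
            refine intervalIntegral.integral_mono_on huv
              ((hf.continuous.mul hgC.continuous).intervalIntegrable _ _)
              ((continuous_const.mul hgC.continuous).intervalIntegrable _ _) fun t ht => ?_
            exact mul_le_mul_of_nonneg_right ((le_abs_self _).trans
              (hM t ⟨hu.trans ht.1, ht.2.trans hv⟩)) (hg0 t)
        _ = M * ∫ t in u..v, g t := intervalIntegral.integral_const_mul _ _
        _ ≤ M * (48 * (v - u) ^ σ) := by
            gcongr
            exact integral_ratKernel_le_rpow hτ (hs.trans hsσ) hσε hε0 (by linarith) hn1 hφ hprimes
              hu huv hv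
        _ = M * (48 * (v - u) ^ (σ - s)) * (v - u) ^ s := by
            have : (v - u) ^ σ = (v - u) ^ (σ - s) * (v - u) ^ s := by
              rw [← Real.rpow_add_of_nonneg hl0 (by linarith) hs.le, sub_add_cancel]
            rw [this]
            ring
        _ ≤ M * (48 * δ ^ (σ - s)) * (v - u) ^ s := by
            have : (v - u) ^ (σ - s) ≤ δ ^ (σ - s) := Real.rpow_le_rpow hl0 hle (by linarith)
            gcongr
        _ ≤ (C + η) * (v - u) ^ s := by
            gcongr
            linarith
    · have h1 := (abs_le.1 (hdisc hu huv hv)).2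
      have h2 : δ ^ s ≤ (v - u) ^ s := Real.rpow_le_rpow hδ0.le hgt.le hs.le
      have h3 := hfC u v hu huv hv
      have h4 : η * δ ^ s ≤ η * (v - u) ^ s := by gcongr
      linarith
  · refine (hdisc le_rfl hx.1 hx.2).trans ?_
    have : δ ^ s ≤ 1 := Real.rpow_le_one hδ0.le hδ1 hs.le
    nlinarith

/-! ### Mass distribution and the lower bound -/

lemma continuous_of_increment_le {F : ℝ → ℝ} (hmono : Monotone F) {C s : ℝ} (hs : 0 < s)
    (hF : ∀ u v, u ≤ v → F v - F u ≤ C * (v - u) ^ s) : Continuous F := by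
  refine continuous_iff_continuousAt.2 fun a => ?_
  have hlim : Tendsto (fun x : ℝ => C * |x - a| ^ s) (𝓝 a) (𝓝 0) := by
    have h1 : ContinuousAt (fun x : ℝ => C * |x - a| ^ s) a :=
      continuousAt_const.mul
        ((continuousAt_id.sub continuousAt_const).abs.rpow_const (Or.inr hs.le))
    simpa [ContinuousAt, Real.zero_rpow hs.ne'] using h1
  rw [ContinuousAt, tendsto_iff_dist_tendsto_zero]
  refine squeeze_zero (fun _ => dist_nonneg) (fun x => ?_) hlim
  rcases le_total a x with h | h
  · rw [Real.dist_eq, abs_of_nonneg (sub_nonneg.2 (hmono h)), abs_of_nonneg (sub_nonneg.2 h)]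
    exact hF a x h
  · rw [Real.dist_eq, abs_sub_comm, abs_sub_comm x, abs_of_nonneg (sub_nonneg.2 (hmono h)),
      abs_of_nonneg (sub_nonneg.2 h)]
    exact hF x a h

/-- Mass distribution principle: if the increments of `F` are at most `C` times the `s`-th power of
the length, the Stieltjes measure of `F` is dominated by `C` times `μH[s]`. -/
lemma stieltjes_measure_eq_zero {F : StieltjesFunction ℝ} {C s : ℝ} (hC : 0 < C) (hs : 0 < s)
    (hF : ∀ u v, u ≤ v → F v - F u ≤ C * (v - u) ^ s) {K : Set ℝ} (hK : μH[s] K = 0) :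
    F.measure K = 0 := by
  have hle : (ENNReal.ofReal C)⁻¹ • F.measure ≤ μH[s] := by
    refine Measure.le_hausdorffMeasure s _ 1 one_pos fun t ht => ?_
    rcases t.eq_empty_or_nonempty with rfl | hne
    · simp
    have hb : Bornology.IsBounded t :=
      Metric.isBounded_iff_ediam_ne_top.2 (ht.trans_lt ENNReal.one_lt_top).ne
    have hsub : t ⊆ Icc (sInf t) (sSup t) := subset_Icc_csInf_csSup hb.bddBelow hb.bddAbove
    have hab : sInf t ≤ sSup t := Real.sInf_le_sSup t hb.bddBelow hb.bddAbove
    have h1 : F.measure t ≤ ENNReal.ofReal C * Metric.ediam t ^ s := by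
      calc F.measure t ≤ F.measure (Icc (sInf t) (sSup t)) := measure_mono hsub
        _ = ENNReal.ofReal (F (sSup t) - F (sInf t)) := by
            rw [F.measure_Icc, (continuous_of_increment_le F.mono hs hF).continuousWithinAt.leftLim_eq]
        _ ≤ ENNReal.ofReal (C * (sSup t - sInf t) ^ s) := ENNReal.ofReal_le_ofReal (hF _ _ hab)
        _ = ENNReal.ofReal C * Metric.ediam t ^ s := by
            rw [ENNReal.ofReal_mul hC.le, Real.ediam_eq hb,
              ENNReal.ofReal_rpow_of_nonneg (by linarith) hs.le]
    rw [Measure.smul_apply, smul_eq_mul]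
    calc (ENNReal.ofReal C)⁻¹ * F.measure t
        ≤ (ENNReal.ofReal C)⁻¹ * (ENNReal.ofReal C * Metric.ediam t ^ s) := by gcongr
      _ = Metric.ediam t ^ s := by
          rw [← mul_assoc, ENNReal.inv_mul_cancel (by simpa using hC) ENNReal.ofReal_ne_top, one_mul]
  have h0 := hle K
  rw [hK, Measure.smul_apply, smul_eq_mul] at h0
  exact (mul_eq_zero.1 (le_antisymm h0 zero_le)).resolve_left
    (ENNReal.inv_ne_zero.2 ENNReal.ofReal_ne_top)

/-- Densities with decreasing supports, uniformly Hölder masses and convergent distribution functions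
yield a set of positive `s`-dimensional Hausdorff measure: the limit distribution function,
extended to `ℝ` by clamping its argument to `[0, 1]`, defines a measure carried by the
intersection of the supports. -/
lemma hausdorffMeasure_iInter_tsupport_ne_zero {s C : ℝ} (hs : 0 < s) (hC : 0 < C)
    {f : ℕ → ℝ → ℝ} (hf : ∀ k, Continuous (f k)) (hf0 : ∀ k x, 0 ≤ f k x)
    (hfC : ∀ k, HolderMass s C (f k)) (hanti : ∀ k, tsupport (f (k + 1)) ⊆ tsupport (f k))
    {G : ℝ → ℝ} (hG : ∀ x ∈ Icc (0 : ℝ) 1,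
      Tendsto (fun k => ∫ t in (0 : ℝ)..x, f k t) atTop (𝓝 (G x)))
    (hG1 : 0 < G 1) : μH[s] (⋂ k, tsupport (f k)) ≠ 0 := by
  intro hzero
  set cl : ℝ → ℝ := fun x => max 0 (min x 1) with hcl
  have hcl01 : ∀ x, cl x ∈ Icc (0 : ℝ) 1 := fun x =>
    ⟨le_max_left _ _, max_le zero_le_one (min_le_right _ _)⟩
  have hclmono : Monotone cl := fun x y hxy =>
    max_le_max le_rfl (min_le_min hxy le_rfl)
  have hcllip : ∀ u v, u ≤ v → cl v - cl u ≤ v - u := fun u v huv => by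
    simp only [hcl, max_def, min_def]
    split_ifs <;> linarith
  have hlim : ∀ u v, Tendsto (fun k => ∫ t in cl u..cl v, f k t) atTop
      (𝓝 (G (cl v) - G (cl u))) := fun u v => by
    refine ((hG _ (hcl01 v)).sub (hG _ (hcl01 u))).congr fun k => ?_
    exact intervalIntegral.integral_interval_sub_left ((hf k).intervalIntegrable _ _)
      ((hf k).intervalIntegrable _ _)
  have hmono : Monotone fun x => G (cl x) := fun u v huv => by
    refine sub_nonneg.1 (ge_of_tendsto' (hlim u v) fun k => ?_)
    exact intervalIntegral.integral_nonneg (hclmono huv) fun t _ => hf0 k t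
  have hHol : ∀ u v, u ≤ v → G (cl v) - G (cl u) ≤ C * (v - u) ^ s := fun u v huv => by
    refine le_of_tendsto' (hlim u v) fun k => ?_
    refine (hfC k _ _ (hcl01 u).1 (hclmono huv) (hcl01 v).2).trans ?_
    have := Real.rpow_le_rpow (sub_nonneg.2 (hclmono huv)) (hcllip u v huv) hs.le
    gcongr
  let F : StieltjesFunction ℝ :=
    { toFun := fun x => G (cl x)
      mono' := hmono
      right_continuous' := fun _ =>
        (continuous_of_increment_le hmono hs hHol).continuousWithinAt }
  have hFdef : ∀ x, F x = G (cl x) := fun _ => rfl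
  have hK : F.measure (⋂ k, tsupport (f k)) = 0 := stieltjes_measure_eq_zero hC hs hHol hzero
  have hKc : F.measure (⋂ k, tsupport (f k))ᶜ = 0 := by
    rw [compl_iInter]
    refine measure_iUnion_null fun k => measure_null_of_locally_null _ fun x hx => ?_
    obtain ⟨ρ, hρ, hball⟩ := Metric.isOpen_iff.1 (isClosed_tsupport (f k)).isOpen_compl x hx
    refine ⟨Ioc (x - ρ / 2) (x + ρ / 2), mem_nhdsWithin_of_mem_nhds
      (Ioc_mem_nhds (by linarith) (by linarith)), ?_⟩
    rw [F.measure_Ioc, ENNReal.ofReal_eq_zero, hFdef, hFdef]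
    refine le_of_eq (tendsto_nhds_unique (hlim _ _) (tendsto_const_nhds.congr' ?_))
    filter_upwards [eventually_ge_atTop k] with j hj
    symm
    rcases (hclmono (show x - ρ / 2 ≤ x + ρ / 2 by linarith)).eq_or_lt with heq | hlt
    · rw [heq, intervalIntegral.integral_same]
    · rw [intervalIntegral.integral_congr (g := fun _ => (0 : ℝ)), intervalIntegral.integral_zero]
      intro t ht
      rw [uIcc_of_le hlt.le] at ht
      -- clamping only shrinks an interval that it does not collapse
      have hends : x - ρ / 2 ≤ cl (x - ρ / 2) ∧ cl (x + ρ / 2) ≤ x + ρ / 2 := by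
        simp only [hcl, max_def, min_def] at hlt ⊢
        split_ifs at hlt ⊢ <;> constructor <;> linarith
      have htx : t ∈ (tsupport (f k))ᶜ := hball (by
        rw [Metric.mem_ball, Real.dist_eq, abs_lt]
        constructor <;> linarith [ht.1, ht.2, hends.1, hends.2])
      exact image_eq_zero_of_notMem_tsupport fun hj' =>
        htx (antitone_nat_of_succ_le (f := fun k => tsupport (f k)) hanti hj hj')
  have huniv : F.measure univ = 0 := by
    rw [← union_compl_self (⋂ k, tsupport (f k))]
    exact measure_union_null hK hKc
  have hG0 : G 0 = 0 :=
    tendsto_nhds_unique (hG 0 ⟨le_rfl, zero_le_one⟩) (by simp)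
  have h01 : F.measure (Ioc 0 1) = ENNReal.ofReal (G 1) := by
    rw [F.measure_Ioc, hFdef, hFdef]
    simp [hcl, hG0]
  have := measure_mono_null (subset_univ (Ioc (0 : ℝ) 1)) huniv
  rw [h01, ENNReal.ofReal_eq_zero] at this
  linarith

/-- Points approximated by fractions of `(0, 1)` with arbitrarily large denominators lie in
`jarnikSet τ`. -/
lemma mem_jarnikSet {τ x : ℝ} (hτ : 2 ≤ τ) (hx : ∀ N : ℕ, ∃ q p : ℕ, N ≤ q ∧ 0 < p ∧ p < q ∧
    |x - (p : ℝ) / q| < 1 / (q : ℝ) ^ τ) : x ∈ jarnikSet τ := by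
  constructor
  · obtain ⟨q, p, -, hp, hpq, h⟩ := hx 0
    have hq1 : (1 : ℝ) ≤ q := by exact_mod_cast hp.trans hpq
    have hq0 : (0 : ℝ) < q := by linarith
    have hqτ : 1 / (q : ℝ) ^ τ ≤ 1 / q := by
      apply one_div_le_one_div_of_le hq0
      simpa using Real.rpow_le_rpow_of_exponent_le hq1 (show 1 ≤ τ by linarith)
    have h1 := abs_lt.1 (h.trans_le hqτ)
    have h2 : 1 / (q : ℝ) ≤ p / q := by
      gcongr
      exact_mod_cast hp
    have h3 : (p : ℝ) / q + 1 / q ≤ 1 := by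
      rw [← add_div, div_le_one hq0]
      exact_mod_cast hpq
    exact ⟨by linarith [h1.1], by linarith [h1.2]⟩
  · intro hfin
    obtain ⟨B, hB⟩ := (hfin.image Prod.snd).bddAbove
    obtain ⟨q, p, hq, hp, hpq, h⟩ := hx (B + 1)
    have := hB ⟨((p : ℤ), q), ⟨hp.trans hpq, by simpa using h⟩, rfl⟩
    simp only at this
    omega

/-- Iterating the refinement step from the constant density `1` on `[0, 1]`. -/
lemma hausdorffMeasure_jarnikSet_ne_zero {τ s : ℝ} (hτ : 2 ≤ τ) (hs : 0 < s) (hsτ : s < 2 / τ) :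
    μH[s] (jarnikSet τ) ≠ 0 := by
  have hs1 : s ≤ 1 := hsτ.le.trans ((div_le_one (by linarith)).2 hτ)
  -- The losses `(1 / 4) * (1 / 2) ^ k` add up to `1 / 2`, so the limit has positive mass, and the
  -- Hölder constants stay below `2`.
  let X : ℕ → Type := fun k =>
    {f : ℝ → ℝ // ContDiff ℝ 1 f ∧ (∀ x, 0 ≤ f x) ∧ HolderMass s (2 - (1 / 2) ^ k) f}
  have hstep : ∀ (k : ℕ) (f : X k), ∃ f' : X (k + 1), tsupport f'.1 ⊆ tsupport f.1 ∧
      (∀ x ∈ tsupport f'.1, ∃ q p : ℕ, k ≤ q ∧ 0 < p ∧ p < q ∧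
        |x - (p : ℝ) / q| < 1 / (q : ℝ) ^ τ) ∧
      ∀ x ∈ Icc (0 : ℝ) 1, |(∫ t in (0 : ℝ)..x, f'.1 t) - ∫ t in (0 : ℝ)..x, f.1 t|
        ≤ 1 / 4 * (1 / 2) ^ k := by
    rintro k ⟨f, hf, hf0, hfC⟩
    have hk : (1 / 2 : ℝ) ^ k ≤ 1 := pow_le_one₀ (by norm_num) (by norm_num)
    obtain ⟨f', h1, h2, h3, h4, h5, h6⟩ := exists_refinement hτ hs hsτ hf hf0
      (show 0 < 2 - (1 / 2 : ℝ) ^ k by linarith) hfC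
      (show 0 < 1 / 4 * (1 / 2 : ℝ) ^ k by positivity) k
    refine ⟨⟨f', h1, h2, fun u v hu huv hv => (h5 u v hu huv hv).trans ?_⟩, h3, h4, h6⟩
    have hpos : (0 : ℝ) < (1 / 2) ^ k := by positivity
    have : 0 ≤ v - u := by linarith
    gcongr
    rw [pow_succ]
    linarith
  choose next hnext using hstep
  have hone : HolderMass s (2 - (1 / 2) ^ 0) fun _ => (1 : ℝ) := fun u v hu huv hv => by
    rcases huv.eq_or_lt with rfl | hlt
    · simp [Real.zero_rpow hs.ne']
    · have := Real.rpow_le_rpow_of_exponent_ge (show 0 < v - u by linarith)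
        (show v - u ≤ 1 by linarith) hs1
      rw [Real.rpow_one] at this
      simp only [intervalIntegral.integral_const, smul_eq_mul]
      linarith
  let F : ∀ k, X k := fun k =>
    Nat.rec ⟨fun _ => 1, contDiff_const, fun _ => zero_le_one, hone⟩ (fun k f => next k f) k
  have hF : ∀ k, F (k + 1) = next k (F k) := fun _ => rfl
  set f : ℕ → ℝ → ℝ := fun k => (F k).1 with hf
  have hdist : ∀ x ∈ Icc (0 : ℝ) 1, ∀ k, dist (∫ t in (0 : ℝ)..x, f k t)
      (∫ t in (0 : ℝ)..x, f (k + 1) t) ≤ 1 / 4 * (1 / 2) ^ k := fun x hx k => by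
    rw [dist_comm, Real.dist_eq]
    exact (hnext k (F k)).2.2 x hx
  have hcauchy : ∀ x ∈ Icc (0 : ℝ) 1, ∃ l,
      Tendsto (fun k => ∫ t in (0 : ℝ)..x, f k t) atTop (𝓝 l) := fun x hx =>
    cauchySeq_tendsto_of_complete (cauchySeq_of_le_geometric _ _ (by norm_num) (hdist x hx))
  choose! G hG using hcauchy
  have h1m : (1 : ℝ) ∈ Icc (0 : ℝ) 1 := ⟨zero_le_one, le_rfl⟩
  have hG1 : 0 < G 1 := by
    have h := dist_le_of_le_geometric_of_tendsto₀ _ _ (by norm_num) (hdist 1 h1m) (hG 1 h1m)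
    have h0 : ∫ t in (0 : ℝ)..1, f 0 t = 1 := by
      change ∫ t in (0 : ℝ)..1, (1 : ℝ) = 1
      simp
    rw [h0, Real.dist_eq] at h
    have := (abs_le.1 h).2
    norm_num at this
    linarith
  have hpos := hausdorffMeasure_iInter_tsupport_ne_zero hs two_pos
    (fun k => (F k).2.1.continuous) (fun k => (F k).2.2.1)
    (fun k u v hu huv hv => ((F k).2.2.2 u v hu huv hv).trans (by
      have : 0 ≤ v - u := by linarith
      have hpow : (0 : ℝ) < (1 / 2) ^ k := by positivity
      gcongr
      linarith))
    (fun k => (hnext k (F k)).1) hG hG1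
  refine fun h0 => hpos (measure_mono_null (fun x hx => mem_jarnikSet hτ fun N => ?_) h0)
  exact (hnext N (F N)).2.1 x (mem_iInter.1 hx (N + 1))

theorem corollary1 (τ : ℝ) (hτ : 2 ≤ τ) :
    dimH (jarnikSet τ) = ENNReal.ofReal (2 / τ) := by
  refine le_antisymm (dimH_jarnikSet_le hτ) (ENNReal.le_of_forall_nnreal_lt fun s hs => ?_)
  rcases eq_or_ne s 0 with rfl | hs0
  · simp
  · rw [ENNReal.ofReal, ENNReal.coe_lt_coe, Real.lt_toNNReal_iff_coe_lt] at hs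
    exact le_dimH_of_hausdorffMeasure_ne_zero
      (hausdorffMeasure_jarnikSet_ne_zero hτ (by exact_mod_cast pos_iff_ne_zero.2 hs0) hs)
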